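/- A Wang bar $b$ is a quadruple $(b_e,b_w,b_n,b_s)$ consisting of an east colour, a west colour, and two words $b_n,b_s$ of the same length $|b|$ over an alphabet $C$ of colours. A tiling of the plane by a set $B$ of Wang bars is a pair of maps $f:\mathbb{Z}^2\to B$ (the bar covering a cell) and $p:\mathbb{Z}^2\to\mathbb{N}$ (the position of the cell inside its bar) such that for all $i,j\in\mathbb{Z}$: * $0<p(i,j)\le |f(i,j)|$; * if $p(i,j)<|f(i,j)|$, then $p(i+1,j)=p(i,j)+1$ and $f(i+1,j)=f(i,j)$; * if $p(i,j)=|f(i,j)|$, then $p(i+1,j)=1$ and $f(i,j)_e=f(i+1,j)_w$; * the $p(i,j)$-th letter of $f(i,j)_n$ equals the $p(i,j+1)$-th letter of $f(i,j+1)_s$. The tiling is periodic if there is an integer $N>0$ such that $f(i+N,j)=f(i,j+N)=f(i,j)$ and $p(i+N,j)=p(i,j+N)=p(i,j)$ for all $i,j$. **Theorem.** Let $B$ be a set of exactly two Wang bars. There is a tiling of the plane by $B$ if and only if there is a periodic tiling of the plane by $B$. Moreover, tileability by two Wang bars is decidable: there is an algorithm which, given two Wang bars $\alpha,\beta$ (with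 colours coded by natural numbers), decides whether there is a tiling of the plane by $\{\alpha,\beta\}$. -/

import Mathlib

/-- A Wang bar with colours in `C`: an east colour, a west colour, and two words of the same
length over `C`, its north and its south side (read from west to east). -/
@[ext] structure WangBar (C : Type*) where
  east : C
  west : C
  north : List C
  south : List C
  length_eq : north.length = south.length

namespace WangBar

/-- The length `|b|` of a Wang bar. -/
def length {C : Type*} (b : WangBar C) : ℕ := b.north.length

/-- `(f, p)` is a tiling of the plane by the barset `B`: `f i j` is the bar covering the cell
`(i, j)` and `p i j` is the position (counted from `1`) of that cell inside its bar. -/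
structure IsTiling {C : Type*} (B : Set (WangBar C)) (f : ℤ → ℤ → WangBar C) (p : ℤ → ℤ → ℕ) :
    Prop where
  mem : ∀ i j, f i j ∈ B
  pos : ∀ i j, 0 < p i j
  le_length : ∀ i j, p i j ≤ (f i j).length
  /-- inside a bar, the next cell to the east is the next cell of the same bar -/
  inside : ∀ i j, p i j < (f i j).length → p (i + 1) j = p i j + 1 ∧ f (i + 1) j = f i j
  /-- at the east end of a bar a new bar starts, and the horizontal colours match -/
  atEnd : ∀ i j, p i j = (f i j).length →
    p (i + 1) j = 1 ∧ (f i j).east = (f (i + 1) j).west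
  /-- vertical colours match; list indices start at `0`, and by `pos` and `le_length` both
  indices are in range, so this is an equality of actual letters -/
  vertical : ∀ i j, (f i j).north[p i j - 1]? = (f i (j + 1)).south[p i (j + 1) - 1]?

/-- A pair `(f, p)` is periodic if some `n > 0` is both a horizontal and a vertical period. -/
def IsPeriodic {C : Type*} (f : ℤ → ℤ → WangBar C) (p : ℤ → ℤ → ℕ) : Prop :=
  ∃ n : ℤ, 0 < n ∧ ∀ i j,
    (f (i + n) j = f i j ∧ p (i + n) j = p i j) ∧ (f i (j + n) = f i j ∧ p i (j + n) = p i j)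

/-- The barset `B` tiles the plane. -/
def TilesPlane {C : Type*} (B : Set (WangBar C)) : Prop :=
  ∃ f p, IsTiling B f p

/-- There is a periodic tiling of the plane by the barset `B`. -/
def HasPeriodicTiling {C : Type*} (B : Set (WangBar C)) : Prop :=
  ∃ f p, IsTiling B f p ∧ IsPeriodic f p

/-- The data of a Wang bar, as a quadruple whose two words have the same length. -/
def equivQuadruple (C : Type*) :
    WangBar C ≃ {q : C × C × List C × List C // q.2.2.1.length = q.2.2.2.length} where
  toFun b := ⟨(b.east, b.west, b.north, b.south), b.length_eq⟩
  invFun q := ⟨q.1.1, q.1.2.1, q.1.2.2.1, q.1.2.2.2, q.2⟩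
  left_inv _ := rfl
  right_inv _ := rfl

theorem primrecPred_length_eq : PrimrecPred
    fun q : ℕ × ℕ × List ℕ × List ℕ => q.2.2.1.length = q.2.2.2.length :=
  Primrec.eq.comp
    (Primrec.list_length.comp (Primrec.fst.comp (Primrec.snd.comp Primrec.snd)))
    (Primrec.list_length.comp (Primrec.snd.comp (Primrec.snd.comp Primrec.snd)))

/-- The standard encoding of Wang bars with colours in `ℕ` (as quadruples), so that such bars
can be inputs of algorithms. -/
instance instPrimcodableNat : Primcodable (WangBar ℕ) :=
  letI := Primcodable.subtype primrecPred_length_eq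
  Primcodable.ofEquiv _ (equivQuadruple ℕ)

end WangBar

/-! Periodicity. A row in which each cell determines its east neighbour is eventually periodic, with
a period depending on the bars only; pigeonhole over the rows then yields a rectangle that can be
repeated (`hasPeriodic_of_rows`). Unless all successions are allowed and no bar is empty, every row
is of this kind.

In the free case a row is an arbitrary sequence of two words. If the two north words, repeated
forever, coincide, or the two south words do, both sides of a row are translates of one periodic
word and shifted copies of a single row tile the plane (`hasPeriodic_of_commute`). If not, rotating
the words past their common prefixes merely shears tilings (`isTiling_conj_iff`), so the first
letters may be assumed to differ. A letter then tells which bar starts there, and determinism passes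
from row to row. Either four aligned starts force an alternating pattern (`hasPeriodic_of_column`),
or four adjacent rows evolve deterministically; then the lowest is eventually periodic, and so are
all rows above it, with a common period (`exists_period`).

Decidability. By compactness an untileable pair fails on some finite square, while a periodic tiling
is a finite witness of tileability. Hence tileability and its negation are both semi-decidable. -/

/-! ### Bar systems and their rows -/

/-- Two bars labelled by `Bool`: their lengths, the allowed horizontal successions, and the letters
on their north and south sides. A cell `(b, k)` is the `k`-th cell (from `0`) of the bar `b`. -/
structure BarSystem (C : Type*) where
  len : Bool → ℕ
  next : Bool → Bool → Prop
  north : Bool × ℕ → C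
  south : Bool × ℕ → C

namespace BarSystem

/-- The cell `t` may stand directly to the east of the cell `s`. -/
structure Adj {C : Type*} (A : BarSystem C) (s t : Bool × ℕ) : Prop where
  lt : s.2 < A.len s.1
  inside : s.2 + 1 < A.len s.1 → t = (s.1, s.2 + 1)
  atEnd : s.2 + 1 = A.len s.1 → t.2 = 0 ∧ A.next s.1 t.1

/-- A bi-infinite row of bars. -/
def IsRow {C : Type*} (A : BarSystem C) (r : ℤ → Bool × ℕ) : Prop :=
  ∀ x, A.Adj (r x) (r (x + 1))

/-- `T j x` is the cell in row `j` and column `x` of a tiling of the plane. -/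
structure IsTiling {C : Type*} (A : BarSystem C) (T : ℤ → ℤ → Bool × ℕ) : Prop where
  row : ∀ j, A.IsRow (T j)
  vert : ∀ j x, A.north (T j x) = A.south (T (j + 1) x)

/-- There is a tiling with a common horizontal and vertical period. -/
def HasPeriodic {C : Type*} (A : BarSystem C) : Prop :=
  ∃ T, A.IsTiling T ∧ ∃ n : ℤ, 0 < n ∧ ∀ j x, T j (x + n) = T j x ∧ T (j + n) x = T j x

/-- The cells of the two bars. -/
def cells {C : Type*} (A : BarSystem C) : Finset (Bool × ℕ) :=
  -- A superset of the actual cells: the sum bounds both lengths, and only finiteness matters.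
  Finset.univ ×ˢ Finset.range (A.len true + A.len false)

variable {C : Type*} {A : BarSystem C}

theorem IsRow.mem_cells {r : ℤ → Bool × ℕ} (hr : A.IsRow r) (x : ℤ) : r x ∈ A.cells := by
  have := (hr x).lt
  simp only [cells, Finset.mem_product, Finset.mem_univ, Finset.mem_range, true_and]
  cases h : (r x).1 <;> rw [h] at this <;> omega

/-- Equal cells have equal east neighbours, or are both followed by the start of a bar. -/
theorem IsRow.step {r r' : ℤ → Bool × ℕ} (hr : A.IsRow r) (hr' : A.IsRow r') {x y : ℤ}
    (h : r x = r' y) : r (x + 1) = r' (y + 1) ∨ (r (x + 1)).2 = 0 ∧ (r' (y + 1)).2 = 0 := by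
  have h1 := (hr x).lt
  rcases Nat.lt_or_ge ((r x).2 + 1) (A.len (r x).1) with h2 | h2
  · left
    rw [(hr x).inside h2, (hr' y).inside (h ▸ h2), h]
  · right
    exact ⟨((hr x).atEnd (by omega)).1, ((hr' y).atEnd (by rw [← h]; omega)).1⟩

/-- A bar that has been started is completed. -/
theorem IsRow.run {r : ℤ → Bool × ℕ} (hr : A.IsRow r) {x : ℤ} {b : Bool} (h : r x = (b, 0))
    (i : ℕ) (hi : i < A.len b) : r (x + i) = (b, i) := by
  induction i with
  | zero => simpa using h
  | succ i ih =>
    have ih := ih (by omega)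
    have := (hr (x + i)).inside (by rw [ih]; exact hi)
    rw [ih] at this
    rw [← this]
    congr 1
    push_cast
    ring

/-! ### Periodicity by repetition and pigeonhole -/

theorem emod_succ_cases (x : ℤ) {n : ℤ} (hn : 0 < n) :
    (x + 1) % n = x % n + 1 ∧ x % n + 1 < n ∨ (x + 1) % n = 0 ∧ x % n + 1 = n := by
  have h1 := Int.emod_nonneg x hn.ne'
  have h2 := Int.emod_lt_of_pos x hn
  have h3 : (x + 1) % n = (x % n + 1) % n := by simp
  rcases lt_or_ge (x % n + 1) n with h | h
  · exact Or.inl ⟨by rw [h3, Int.emod_eq_of_lt (by omega) h], h⟩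
  · have h4 : x % n + 1 = n := by omega
    exact Or.inr ⟨by rw [h3, h4, Int.emod_self], h4⟩

/-- A rectangle of a tiling whose opposite sides agree can be repeated periodically. -/
theorem IsTiling.hasPeriodic_of_patch {T : ℤ → ℤ → Bool × ℕ} (hT : A.IsTiling T) (a b P Q : ℤ)
    (hP : 0 < P) (hQ : 0 < Q) (hcol : ∀ j, b ≤ j → j < b + Q → T j (a + P) = T j a)
    (hrow : ∀ x, a ≤ x → x < a + P → T (b + Q) x = T b x) : A.HasPeriodic := by
  refine ⟨fun j x => T (b + j % Q) (a + x % P), ⟨fun j x => ?_, fun j x => ?_⟩, P * Q,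
    mul_pos hP hQ, fun j x => by simp⟩
  · have h0 := hT.row (b + j % Q) (a + x % P)
    have h1 := Int.emod_nonneg j hQ.ne'
    have h2 := Int.emod_lt_of_pos j hQ
    rcases emod_succ_cases x hP with ⟨h, -⟩ | ⟨h, h'⟩
    · simp only [h]
      rwa [add_assoc] at h0
    · simp only [h, add_zero]
      rwa [add_assoc, h', hcol _ (by omega) (by omega)] at h0
  · have h0 := hT.vert (b + j % Q) (a + x % P)
    have h1 := Int.emod_nonneg x hP.ne'
    have h2 := Int.emod_lt_of_pos x hP
    rcases emod_succ_cases j hQ with ⟨h, -⟩ | ⟨h, h'⟩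
    · simp only [h]
      rwa [add_assoc] at h0
    · simp only [h, add_zero]
      rwa [add_assoc, h', hrow _ (by omega) (by omega)] at h0

theorem eq_add_mul_of_periodic_from {X : Type*} {s : ℤ → X} {a d : ℤ} (hd : 0 ≤ d)
    (h : ∀ x, a ≤ x → s (x + d) = s x) (k : ℕ) {x : ℤ} (hx : a ≤ x) : s (x + k * d) = s x := by
  induction k with
  | zero => simp
  | succ k ih =>
    rw [← ih, ← h (x + k * d) (by nlinarith [mul_nonneg (Int.natCast_nonneg k) hd])]
    congr 1
    push_cast
    ring

/-- A sequence in a finite set in which each term determines the next is eventually periodic. -/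
theorem exists_factorial_period {X : Type*} (s : ℤ → X) (F : Finset X) (a : ℤ)
    (hF : ∀ x, a ≤ x → s x ∈ F)
    (det : ∀ x y, a ≤ x → a ≤ y → s x = s y → s (x + 1) = s (y + 1)) :
    ∃ c, ∀ x, c ≤ x → s (x + (F.card.factorial : ℕ)) = s x := by
  obtain ⟨i, hi, j, hj, hij, he⟩ := Finset.exists_ne_map_eq_of_card_lt_of_maps_to
    (s := Finset.range (F.card + 1)) (t := F) (f := fun i : ℕ => s (a + i)) (by simp)
    (fun i _ => hF _ (by omega))
  wlog hlt : i < j generalizing i j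
  · exact this j hj i hi hij.symm he.symm (by omega)
  rw [Finset.mem_range] at hi hj
  have key : ∀ k : ℕ, s (a + i + k + (j - i : ℕ)) = s (a + i + k) := by
    intro k
    induction k with
    | zero =>
      rw [Nat.cast_zero, add_zero, he]
      congr 1
      omega
    | succ k ih =>
      have := det _ _ (by omega) (by omega) ih
      convert this using 2 <;> push_cast <;> ring
  have key' : ∀ x, a + i ≤ x → s (x + (j - i : ℕ)) = s x := by
    intro x hx
    obtain ⟨k, rfl⟩ := Int.le.dest hx
    exact key k
  refine ⟨a + i, fun x hx => ?_⟩
  -- The period found is at most `F.card`, so it divides the factorial, which is the same for all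
  -- sequences in `F`.
  obtain ⟨k, hk⟩ := Nat.dvd_factorial (m := j - i) (n := F.card) (by omega) (by omega)
  have := eq_add_mul_of_periodic_from (by positivity) key' k hx
  rw [← this, hk]
  congr 1
  push_cast
  ring

/-- If the rows above some row are all eventually periodic to the east, with a common period,
then there is a periodic tiling. -/
theorem IsTiling.hasPeriodic_of_rows {T : ℤ → ℤ → Bool × ℕ} (hT : A.IsTiling T) (Q : ℕ)
    (hQ : 0 < Q) (h : ∀ j : ℕ, ∃ c, ∀ x, c ≤ x → T j (x + Q) = T j x) : A.HasPeriodic := by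
  choose c hc using h
  -- One period of row `j`, read from a multiple of `Q` beyond `c j`. Having all blocks in phase
  -- allows two rows with equal blocks to be compared in the same columns.
  let g : ℕ → (Fin Q → A.cells) := fun j r =>
    ⟨T j ((c j).toNat * Q + (r : ℕ)), (hT.row j).mem_cells _⟩
  obtain ⟨i, j, hij, he⟩ := Finite.exists_ne_map_eq_of_infinite g
  wlog hlt : i < j generalizing i j
  · exact this j i hij.symm he.symm (by omega)
  obtain ⟨M, hM⟩ : ∃ M : ℕ, ∀ k ≤ j, c k ≤ M := by
    refine ⟨(Finset.range (j + 1)).sup fun k => (c k).toNat, fun k hk => ?_⟩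
    have := Finset.le_sup (f := fun k => (c k).toNat) (Finset.mem_range.2 (Nat.lt_succ_of_le hk))
    exact Int.toNat_le.1 this
  have hMQ : ∀ k ≤ j, c k ≤ (M * Q : ℕ) := fun k hk => (hM k hk).trans (by
    exact_mod_cast Nat.le_mul_of_pos_right M hQ)
  have val : ∀ k ≤ j, ∀ r : Fin Q, T k ((M * Q : ℕ) + (r : ℕ)) = g k r := by
    intro k hk r
    have h1 : c k ≤ ((c k).toNat * Q + (r : ℕ) : ℕ) := by
      have := Nat.le_mul_of_pos_right (c k).toNat hQ
      omega
    have h2 := eq_add_mul_of_periodic_from (s := T k) (by positivity) (hc k) (M - (c k).toNat) h1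
    simp only [g]
    rw [Nat.cast_add] at h2
    push_cast at h2 ⊢
    rw [← h2]
    congr 1
    have := hM k hk
    rw [Nat.cast_sub (by omega)]
    ring
  refine hT.hasPeriodic_of_patch (M * Q : ℕ) i Q (j - i) (by omega) (by omega) ?_ ?_
  · intro k h1 h2
    obtain ⟨k, rfl⟩ := Int.eq_ofNat_of_zero_le (a := k) (by omega)
    exact hc k _ (hMQ k (by omega))
  · intro x h1 h2
    obtain ⟨r, hr⟩ := Int.le.dest h1
    have h3 := val i hlt.le ⟨r, by omega⟩
    have h4 := val j le_rfl ⟨r, by omega⟩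
    rw [he, ← h4] at h3
    simp only [hr] at h3
    rw [h3]
    congr 1
    ring

/-- If in every row each cell determines its east neighbour, there is a periodic tiling. -/
theorem IsTiling.hasPeriodic_of_deterministic {T : ℤ → ℤ → Bool × ℕ} (hT : A.IsTiling T)
    (h : ∀ j x y, T j x = T j y → T j (x + 1) = T j (y + 1)) : A.HasPeriodic :=
  hT.hasPeriodic_of_rows _ (Nat.factorial_pos A.cells.card) fun j =>
    exists_factorial_period (T j) A.cells 0 (fun x _ => (hT.row j).mem_cells x)
      fun x y _ _ => h j x y

/-! ### Unrestricted successions: words with equal infinite repetitions -/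

/-- There is no restriction on horizontal successions, and no bar is empty. -/
structure Free {C : Type*} (A : BarSystem C) : Prop where
  next : ∀ b b', A.next b b'
  pos : ∀ b, 0 < A.len b

/-- The bar `b` repeated to the east. -/
theorem Free.isRow_const (hA : A.Free) (b : Bool) :
    A.IsRow fun x => (b, (x % A.len b).toNat) := by
  intro x
  have hb : (0 : ℤ) < A.len b := by exact_mod_cast hA.pos b
  have h1 := Int.emod_nonneg x hb.ne'
  have h2 := Int.emod_lt_of_pos x hb
  refine ⟨by dsimp only; omega, fun h => ?_, fun h => ?_⟩
  · dsimp only at h ⊢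
    rcases emod_succ_cases x hb with ⟨h3, -⟩ | ⟨h3, h4⟩
    · rw [h3]
      congr 1
      omega
    · omega
  · dsimp only at h ⊢
    rcases emod_succ_cases x hb with ⟨h3, h4⟩ | ⟨h3, h4⟩
    · omega
    · exact ⟨by rw [h3]; rfl, hA.next _ _⟩

/-- A bar with equal north and south sides tiles the plane. -/
theorem Free.hasPeriodic_of_north_eq_south (hA : A.Free) (b : Bool)
    (h : ∀ i < A.len b, A.north (b, i) = A.south (b, i)) : A.HasPeriodic := by
  have hb : (0 : ℤ) < A.len b := by exact_mod_cast hA.pos b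
  refine ⟨fun _ x => (b, (x % A.len b).toNat), ⟨fun _ => hA.isRow_const b, fun _ x => h _ ?_⟩,
    A.len b, hb, fun j x => by simp⟩
  have := Int.emod_lt_of_pos x hb
  omega

/-- If the north and south sides of a row are, from some column on, translates of one periodic
word, then this row can be used for a periodic tiling. -/
theorem IsRow.hasPeriodic_of_translates {r : ℤ → Bool × ℕ} (hr : A.IsRow r) (X : ℤ → C) (M : ℕ)
    (hM : 0 < M) (hX : ∀ x, X (x + M) = X x) (c d e : ℤ) (hN : ∀ x, c ≤ x → A.north (r x) = X (x - d))
    (hS : ∀ x, c ≤ x → A.south (r x) = X (x - e)) : A.HasPeriodic := by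
  have hM' : (0 : ℤ) < M := by exact_mod_cast hM
  have hXmul : ∀ (k : ℤ) x, X (x + M * k) = X x := by
    intro k x
    induction k using Int.induction_on with
    | zero => simp
    | succ k ih => rw [mul_add, mul_one, ← add_assoc, hX, ih]
    | pred k ih => rw [← hX, ← ih]; congr 1; ring
  -- Sampling at multiples of `M` keeps `X` in phase when the row is closed up between two equal
  -- cells.
  let g : ℕ → A.cells := fun i => ⟨r (c + i * M), hr.mem_cells _⟩
  obtain ⟨i, j, hij, he⟩ := Finite.exists_ne_map_eq_of_infinite g
  wlog hlt : i < j generalizing i j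
  · exact this j i hij.symm he.symm (by omega)
  have he : r (c + i * M) = r (c + j * M) := congrArg Subtype.val he
  obtain ⟨a, ha⟩ : ∃ a : ℤ, a = c + i * M := ⟨_, rfl⟩
  have hca : c ≤ a := by
    have : (0 : ℤ) ≤ i * M := by positivity
    omega
  obtain ⟨P, hPdef⟩ : ∃ P : ℤ, P = M * (j - i) := ⟨_, rfl⟩
  have hP : 0 < P := hPdef ▸ mul_pos hM' (by omega)
  have haP : a + P = c + j * M := by rw [ha, hPdef]; ring
  rw [← haP, ← ha] at he
  let s : ℤ → Bool × ℕ := fun x => r (a + x % P)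
  have hsP : ∀ (k : ℤ) x, s (x + k * P) = s x := fun k x => by simp [s]
  have hs : A.IsRow s := by
    intro x
    have h0 := hr (a + x % P)
    rcases emod_succ_cases x hP with ⟨h, -⟩ | ⟨h, h'⟩
    · simp only [s, h]
      rwa [add_assoc] at h0
    · simp only [s, h, add_zero]
      rwa [add_assoc, h', ← he] at h0
  have hmod : ∀ x f, X (a + x % P - f) = X (a + x - f) := by
    intro x f
    rw [← hXmul ((j - i) * (x / P)) (a + x % P - f)]
    congr 1
    have := Int.emod_add_mul_ediv x P
    rw [hPdef] at this ⊢
    linear_combination this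
  have hsN : ∀ x, A.north (s x) = X (a + x - d) := fun x =>
    (hN _ (by have := Int.emod_nonneg x hP.ne'; omega)).trans (hmod x d)
  have hsS : ∀ x, A.south (s x) = X (a + x - e) := fun x =>
    (hS _ (by have := Int.emod_nonneg x hP.ne'; omega)).trans (hmod x e)
  -- The north side of row `k` and the south side of row `k + 1` both read `X (a + x + k * (e - d) -
  -- d)`. After `P` rows the total shift is a multiple of `P`.
  refine ⟨fun k x => s (x + k * (e - d)), ⟨fun k x => ?_, fun k x => ?_⟩, P, hP,
    fun k x => ⟨?_, ?_⟩⟩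
  · have := hs (x + k * (e - d))
    rwa [add_right_comm] at this
  · rw [hsN, hsS]
    congr 1
    ring
  · dsimp only
    rw [← hsP 1 (x + k * (e - d))]
    congr 1
    ring
  · dsimp only
    rw [← hsP (e - d) (x + k * (e - d))]
    congr 1
    ring

/-- If two bars repeated to the east read the same, then so does every row, from the start of a
bar on. -/
theorem IsRow.eq_translate {r : ℤ → Bool × ℕ} (hr : A.IsRow r) (g : Bool × ℕ → C)
    (h : ∀ i : ℕ, g (true, i % A.len true) = g (false, i % A.len false)) :
    ∃ d : ℤ, ∀ x, 0 ≤ x → g (r x) = g (true, ((x - d) % A.len true).toNat) := by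
  have hb : ∀ b (i : ℕ), g (b, i % A.len b) = g (true, i % A.len true) := by
    rintro (_ | _) i
    exacts [(h i).symm, rfl]
  -- Invariant: the infinite word with `(r 0).2 + k` letters dropped is also what remains of it at
  -- offset `(r k).2`. Dropping one whole bar changes nothing, since both bars have the same
  -- infinite repetition.
  have key : ∀ k : ℕ, ∀ i : ℕ, g (true, ((r 0).2 + k + i) % A.len true) =
      g (true, ((r k).2 + i) % A.len true) := by
    intro k
    induction k with
    | zero => simp
    | succ k ih =>
      intro i
      have h1 := ih (i + 1)
      rw [show (r 0).2 + (k + 1) + i = (r 0).2 + k + (i + 1) by ring, h1]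
      have h2 := (hr k).lt
      rcases Nat.lt_or_ge ((r k).2 + 1) (A.len (r k).1) with h3 | h3
      · have h4 := (hr k).inside h3
        push_cast
        rw [h4]
        congr 3
        dsimp only
        ring
      · have h4 : (r k).2 + 1 = A.len (r k).1 := by omega
        have h5 := ((hr k).atEnd h4).1
        push_cast
        rw [h5, ← hb (r k).1, ← hb (r k).1 (0 + i),
          show (r k).2 + (i + 1) = 0 + i + A.len (r k).1 by omega, Nat.add_mod_right]
  refine ⟨-(r 0).2, fun x hx => ?_⟩
  obtain ⟨k, rfl⟩ := Int.eq_ofNat_of_zero_le hx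
  have h1 := key k 0
  rw [add_zero, add_zero, ← hb (r k).1 (r k).2, Nat.mod_eq_of_lt (hr k).lt] at h1
  rw [← show _ = g (r k) from h1]
  congr 2
  rw [show (k : ℤ) - -((r 0).2 : ℤ) = ((r 0).2 + k : ℕ) by push_cast; ring, ← Int.natCast_mod,
    Int.toNat_natCast]

/-- If the two north words repeated to the east read the same, or the two south words do, there is
a periodic tiling. -/
theorem IsTiling.hasPeriodic_of_commute {T : ℤ → ℤ → Bool × ℕ} (hT : A.IsTiling T) (hA : A.Free)
    (g : Bool × ℕ → C) (hg : g = A.north ∨ g = A.south)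
    (h : ∀ i : ℕ, g (true, i % A.len true) = g (false, i % A.len false)) : A.HasPeriodic := by
  -- Each side of row 0 is also the facing side of an adjacent row, so words of one kind control
  -- both.
  obtain ⟨j, j', hj, hj'⟩ : ∃ j j', (∀ x, A.north (T 0 x) = g (T j x)) ∧
      ∀ x, A.south (T 0 x) = g (T j' x) := by
    rcases hg with rfl | rfl
    · exact ⟨0, -1, fun _ => rfl, fun x => (by simpa using (hT.vert (-1) x).symm)⟩
    · exact ⟨1, 0, fun x => hT.vert 0 x, fun _ => rfl⟩
  obtain ⟨d, hd⟩ := (hT.row j).eq_translate g h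
  obtain ⟨e, he⟩ := (hT.row j').eq_translate g h
  refine (hT.row 0).hasPeriodic_of_translates (fun x => g (true, (x % A.len true).toNat))
    (A.len true) (hA.pos _) (by simp) 0 d e (fun x hx => ?_) fun x hx => ?_
  · rw [hj, hd x hx]
  · rw [hj', he x hx]

/-! ### Rotating away common prefixes -/

/-- The letters of a bar, rotated by `k` places. -/
def rotate {C : Type*} (A : BarSystem C) (g : Bool × ℕ → C) (k : ℕ) (s : Bool × ℕ) : C :=
  g (s.1, (k + s.2) % A.len s.1)

/-- If the two words repeated to the east agree at the first `k` places, then rotating both words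
by `k` places amounts to translating the rows by `k`. -/
theorem IsRow.rotate_eq {r : ℤ → Bool × ℕ} (hr : A.IsRow r) (g : Bool × ℕ → C) (k : ℕ)
    (h : ∀ i < k, g (true, i % A.len true) = g (false, i % A.len false)) (x : ℤ) :
    A.rotate g k (r x) = g (r (x + k)) := by
  have hb : ∀ b b', ∀ i < k, g (b, i % A.len b) = g (b', i % A.len b') := by
    rintro (_ | _) (_ | _) i hi
    exacts [rfl, (h i hi).symm, h i hi, rfl]
  -- Wrapping around inside a bar agrees with reading on into the next bar as long as the overshoot
  -- is less than `k`.
  have key : ∀ q : ℕ, ∀ x, (r x).2 + q < A.len (r x).1 + k →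
      g ((r x).1, ((r x).2 + q) % A.len (r x).1) = g (r (x + q)) := by
    intro q
    induction q with
    | zero => intro x _; simp [Nat.mod_eq_of_lt (hr x).lt]
    | succ q ih =>
      intro x hx
      have h1 := (hr x).lt
      have h2 : x + (q + 1 : ℕ) = x + 1 + q := by push_cast; ring
      rw [h2]
      rcases Nat.lt_or_ge ((r x).2 + 1) (A.len (r x).1) with h3 | h3
      · have h4 := (hr x).inside h3
        rw [← ih (x + 1) (by rw [h4]; dsimp only; omega), h4]
        congr 3
        dsimp only
        ring
      · have h4 : (r x).2 + 1 = A.len (r x).1 := by omega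
        have h5 := ((hr x).atEnd h4).1
        rw [← ih (x + 1) (by rw [h5]; omega), h5, hb (r (x + 1)).1 (r x).1 (0 + q) (by omega),
          show (r x).2 + (q + 1) = 0 + q + A.len (r x).1 by omega, Nat.add_mod_right]
  rw [← key k x (by have := (hr x).lt; omega), rotate, add_comm]

/-- The bars whose north sides are rotated by `k` places and whose south sides are rotated by `l`
places. -/
def conj {C : Type*} (A : BarSystem C) (k l : ℕ) : BarSystem C where
  len := A.len
  next := A.next
  north := A.rotate A.north k
  south := A.rotate A.south l

theorem isRow_conj {k l : ℕ} {r : ℤ → Bool × ℕ} : (A.conj k l).IsRow r ↔ A.IsRow r :=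
  forall_congr' fun _ => ⟨fun h => ⟨h.lt, h.inside, h.atEnd⟩, fun h => ⟨h.lt, h.inside, h.atEnd⟩⟩

theorem IsRow.translate {r : ℤ → Bool × ℕ} (hr : A.IsRow r) (c : ℤ) :
    A.IsRow fun x => r (x + c) := fun x => by
  have := hr (x + c)
  rwa [add_right_comm] at this

/-- A tiling by the rotated bars is a sheared tiling by the original bars. -/
theorem isTiling_conj_iff {k l : ℕ}
    (hk : ∀ i < k, A.north (true, i % A.len true) = A.north (false, i % A.len false))
    (hl : ∀ i < l, A.south (true, i % A.len true) = A.south (false, i % A.len false))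
    {T : ℤ → ℤ → Bool × ℕ} : (A.conj k l).IsTiling T ↔
    A.IsTiling fun j x => T j (x - j * (k - l)) := by
  constructor
  · intro hT
    refine ⟨fun j => (isRow_conj.1 (hT.row j)).translate _, fun j x => ?_⟩
    have h1 := (isRow_conj.1 (hT.row j)).rotate_eq A.north k hk (x - j * (k - l) - k)
    have h2 := (isRow_conj.1 (hT.row (j + 1))).rotate_eq A.south l hl (x - j * (k - l) - k)
    have h3 : A.rotate A.north k _ = A.rotate A.south l _ := hT.vert j (x - j * (k - l) - k)
    rw [h1, h2] at h3
    convert h3 using 3 <;> ring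
  · intro hT
    have hr : ∀ j, A.IsRow (T j) := fun j => by
      simpa using (hT.row j).translate (j * (k - l))
    refine ⟨fun j => isRow_conj.2 (hr j), fun j x => ?_⟩
    change A.rotate A.north k _ = A.rotate A.south l _
    rw [(hr j).rotate_eq _ _ hk, (hr _).rotate_eq _ _ hl]
    convert hT.vert j (x + k + j * (k - l)) using 3 <;> ring

/-- Shearing keeps periodicity: over `n` rows the shear adds up to a multiple of the horizontal
period `n`. -/
theorem hasPeriodic_of_conj {k l : ℕ}
    (hk : ∀ i < k, A.north (true, i % A.len true) = A.north (false, i % A.len false))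
    (hl : ∀ i < l, A.south (true, i % A.len true) = A.south (false, i % A.len false))
    (h : (A.conj k l).HasPeriodic) : A.HasPeriodic := by
  obtain ⟨T, hT, n, hn, hp⟩ := h
  have hmul : ∀ (c : ℤ) j x, T j (x + n * c) = T j x := by
    intro c j x
    induction c using Int.induction_on with
    | zero => simp
    | succ c ih => rw [mul_add, mul_one, ← add_assoc, (hp _ _).1, ih]
    | pred c ih => rw [← (hp _ _).1, ← ih]; congr 1; ring
  refine ⟨_, (isTiling_conj_iff hk hl).1 hT, n, hn, fun j x => ⟨?_, ?_⟩⟩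
  · rw [← (hp j (x - j * (k - l))).1]
    congr 1
    ring
  · rw [(hp _ _).2, ← hmul (k - l) j]
    congr 1
    ring

theorem IsTiling.conj {k l : ℕ}
    (hk : ∀ i < k, A.north (true, i % A.len true) = A.north (false, i % A.len false))
    (hl : ∀ i < l, A.south (true, i % A.len true) = A.south (false, i % A.len false))
    {T : ℤ → ℤ → Bool × ℕ} (hT : A.IsTiling T) :
    (A.conj k l).IsTiling fun j x => T j (x + j * (k - l)) :=
  (isTiling_conj_iff hk hl).2 (by simpa using hT)

/-! ### Marked bars -/

/-- There is no restriction on horizontal successions, no bar is empty, and both the two north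
words and the two south words differ in their first letters. -/
structure Marked {C : Type*} (A : BarSystem C) : Prop extends A.Free where
  north_inj : ∀ b b', A.north (b, 0) = A.north (b', 0) → b = b'
  south_inj : ∀ b b', A.south (b, 0) = A.south (b', 0) → b = b'

/-- Equal cells in two rows have equal east neighbours, if the latter are read by a function that
tells the starts of bars apart and gives equal values. -/
theorem IsRow.step_eq {r r' : ℤ → Bool × ℕ} (hr : A.IsRow r) (hr' : A.IsRow r') {g : Bool × ℕ → C}
    (hg : ∀ b b', g (b, 0) = g (b', 0) → b = b') {x y : ℤ} (h : r x = r' y)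
    (he : g (r (x + 1)) = g (r' (y + 1))) : r (x + 1) = r' (y + 1) := by
  rcases hr.step hr' h with h1 | ⟨h1, h2⟩
  · exact h1
  · have h3 : r (x + 1) = ((r (x + 1)).1, 0) := by rw [← h1]
    have h4 : r' (y + 1) = ((r' (y + 1)).1, 0) := by rw [← h2]
    rw [h3, h4] at he ⊢
    rw [hg _ _ he]

/-- The letter on a horizontal edge identifies a bar starting on either side of it. So knowledge of
an east neighbour passes down to the row below, and up in `step_south`. -/
theorem IsTiling.step_north (hA : A.Marked) {T : ℤ → ℤ → Bool × ℕ} (hT : A.IsTiling T) {i j x y : ℤ}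
    (h : T i x = T j y) (h' : T (i + 1) (x + 1) = T (j + 1) (y + 1)) :
    T i (x + 1) = T j (y + 1) :=
  (hT.row i).step_eq (hT.row j) hA.north_inj h (by rw [hT.vert, hT.vert, h'])

theorem IsTiling.step_south (hA : A.Marked) {T : ℤ → ℤ → Bool × ℕ} (hT : A.IsTiling T) {i j x y : ℤ}
    (h : T (i + 1) x = T (j + 1) y) (h' : T i (x + 1) = T j (y + 1)) :
    T (i + 1) (x + 1) = T (j + 1) (y + 1) :=
  (hT.row _).step_eq (hT.row _) hA.south_inj h (by rw [← hT.vert, ← hT.vert, h'])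

/-- If two vertically adjacent bars are equal and start in the same column, there is a periodic
tiling. -/
theorem IsTiling.hasPeriodic_of_eq (hA : A.Marked) {T : ℤ → ℤ → Bool × ℕ} (hT : A.IsTiling T)
    {j x : ℤ} (h : (T j x).2 = 0) (h' : (T (j + 1) x).2 = 0)
    (he : (T j x).1 = (T (j + 1) x).1) : A.HasPeriodic := by
  refine hA.hasPeriodic_of_north_eq_south (T j x).1 fun i hi => ?_
  have h1 := (hT.row j).run (by rw [← h]) i hi
  have h2 := (hT.row (j + 1)).run (b := (T j x).1) (by rw [he, ← h']) i hi
  have h3 := hT.vert j (x + i)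
  rwa [h1, h2] at h3

/-- If bars start in four consecutive rows of a column, there is a periodic tiling: otherwise the
bars alternate in this column, and to the east of it the upper two rows repeat the lower two. -/
theorem IsTiling.hasPeriodic_of_column (hA : A.Marked) {T : ℤ → ℤ → Bool × ℕ} (hT : A.IsTiling T)
    {x : ℤ} (h : ∀ j, 0 ≤ j → j ≤ 3 → (T j x).2 = 0) : A.HasPeriodic := by
  by_contra hno
  have alt : ∀ y j, (T j y).2 = 0 → (T (j + 1) y).2 = 0 → (T (j + 2) y).2 = 0 →
      T j y = T (j + 2) y := by
    intro y j h0 h1 h2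
    have e1 : (T j y).1 ≠ (T (j + 1) y).1 := fun he => hno (hT.hasPeriodic_of_eq hA h0 h1 he)
    have e2 : (T (j + 1) y).1 ≠ (T (j + 2) y).1 := fun he =>
      hno (hT.hasPeriodic_of_eq hA h1 (by rw [add_assoc]; exact h2) (by rw [add_assoc]; exact he))
    refine Prod.ext ?_ (h0.trans h2.symm)
    revert e1 e2
    cases (T j y).1 <;> cases (T (j + 1) y).1 <;> cases (T (j + 2) y).1 <;> simp
  have key : ∀ k : ℕ, T 0 (x + k) = T 2 (x + k) ∧ T 1 (x + k) = T 3 (x + k) := by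
    intro k
    induction k with
    | zero =>
      simp only [Nat.cast_zero, add_zero]
      exact ⟨alt x 0 (h 0 (by simp) (by simp)) (h 1 (by simp) (by simp)) (h 2 (by simp) (by simp)),
        alt x 1 (h 1 (by simp) (by simp)) (h 2 (by simp) (by simp)) (h 3 (by simp) (by simp))⟩
    | succ k ih =>
      obtain ⟨h02, h13⟩ := ih
      push_cast
      rw [← add_assoc]
      -- If one of the two pairs of rows continues inside a bar, the other pair follows through the
      -- common edge. Otherwise bars start in all four rows again, and `alt` applies.
      rcases (hT.row 0).step (hT.row 2) h02 with e | ⟨e0, e2⟩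
      · exact ⟨e, hT.step_south hA (i := 0) (j := 2) h13 e⟩
      · rcases (hT.row 1).step (hT.row 3) h13 with e | ⟨e1, e3⟩
        · exact ⟨hT.step_north hA (i := 0) (j := 2) h02 e, e⟩
        · exact ⟨alt _ 0 e0 e1 e2, alt _ 1 e1 e2 e3⟩
  let g : ℕ → A.cells × A.cells := fun i =>
    (⟨T 0 (x + i), (hT.row 0).mem_cells _⟩, ⟨T 1 (x + i), (hT.row 1).mem_cells _⟩)
  obtain ⟨i, j, hij, he⟩ := Finite.exists_ne_map_eq_of_infinite g
  wlog hlt : i < j generalizing i j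
  · exact this j i hij.symm he.symm (by omega)
  have he0 : T 0 (x + i) = T 0 (x + j) := congrArg (fun p => (p.1 : Bool × ℕ)) he
  have he1 : T 1 (x + i) = T 1 (x + j) := congrArg (fun p => (p.2 : Bool × ℕ)) he
  refine hno (hT.hasPeriodic_of_patch (x + i) 0 (j - i) 2 (by omega) (by simp) ?_ ?_)
  · intro r h0 h2
    rw [show x + i + (j - i : ℤ) = x + j by ring]
    obtain rfl | rfl : r = 0 ∨ r = 1 := by omega
    exacts [he0.symm, he1.symm]
  · intro y hy _
    obtain ⟨n, rfl⟩ := Int.le.dest hy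
    have := (key (i + n)).1
    push_cast at this
    rw [← add_assoc] at this
    exact this.symm

/-- If no bars start in the same column of four consecutive rows, the lowest of these rows is
eventually periodic. -/
theorem IsTiling.exists_period_of_no_column (hA : A.Marked) {T : ℤ → ℤ → Bool × ℕ}
    (hT : A.IsTiling T) (h : ∀ x, ∃ j, 0 ≤ j ∧ j ≤ 3 ∧ (T j x).2 ≠ 0) :
    ∃ Q : ℕ, 0 < Q ∧ ∃ c, ∀ x, c ≤ x → T 0 (x + Q) = T 0 x := by
  have det : ∀ x y, (T 0 x, T 1 x, T 2 x, T 3 x) = (T 0 y, T 1 y, T 2 y, T 3 y) →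
      (T 0 (x + 1), T 1 (x + 1), T 2 (x + 1), T 3 (x + 1)) =
        (T 0 (y + 1), T 1 (y + 1), T 2 (y + 1), T 3 (y + 1)) := by
    intro x y hxy
    simp only [Prod.mk.injEq] at hxy ⊢
    obtain ⟨h0, h1, h2, h3⟩ := hxy
    have inside : ∀ j, T j x = T j y → (T j (x + 1)).2 ≠ 0 → T j (x + 1) = T j (y + 1) := by
      intro j hj hne
      rcases (hT.row j).step (hT.row j) hj with e | e
      exacts [e, absurd e.1 hne]
    have up0 := fun e => hT.step_south hA (i := 0) (j := 0) h1 e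
    have up1 := fun e => hT.step_south hA (i := 1) (j := 1) h2 e
    have up2 := fun e => hT.step_south hA (i := 2) (j := 2) h3 e
    have down0 := fun e => hT.step_north hA (i := 0) (j := 0) h0 e
    have down1 := fun e => hT.step_north hA (i := 1) (j := 1) h1 e
    have down2 := fun e => hT.step_north hA (i := 2) (j := 2) h2 e
    simp only [show (0 : ℤ) + 1 = 1 from rfl, show (1 : ℤ) + 1 = 2 from rfl,
      show (2 : ℤ) + 1 = 3 from rfl] at up0 up1 up2 down0 down1 down2
    -- Some row is inside a bar at `x + 1`, so its cell there is forced; the other three follow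
    -- upwards and downwards.
    obtain ⟨j, hj0, hj3, hj⟩ := h (x + 1)
    obtain rfl | rfl | rfl | rfl : j = 0 ∨ j = 1 ∨ j = 2 ∨ j = 3 := by omega
    · have e := inside 0 h0 hj; exact ⟨e, up0 e, up1 (up0 e), up2 (up1 (up0 e))⟩
    · have e := inside 1 h1 hj; exact ⟨down0 e, e, up1 e, up2 (up1 e)⟩
    · have e := inside 2 h2 hj; exact ⟨down0 (down1 e), down1 e, e, up2 e⟩
    · have e := inside 3 h3 hj; exact ⟨down0 (down1 (down2 e)), down1 (down2 e), down2 e, e⟩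
  refine ⟨_, Nat.factorial_pos (A.cells ×ˢ A.cells ×ˢ A.cells ×ˢ A.cells).card, ?_⟩
  obtain ⟨c, hc⟩ := exists_factorial_period (fun x => (T 0 x, T 1 x, T 2 x, T 3 x))
    (A.cells ×ˢ A.cells ×ˢ A.cells ×ˢ A.cells) 0
    (fun x _ => by simp only [Finset.mem_product, (hT.row _).mem_cells, and_self])
    fun x y _ _ => det x y
  exact ⟨c, fun x hx => congrArg Prod.fst (hc x hx)⟩

/-- A row whose south side is eventually periodic is eventually periodic, with the same period or
with a period that depends on the bars only. -/
theorem IsRow.exists_period (hA : A.Marked) {r : ℤ → Bool × ℕ} (hr : A.IsRow r) (Q : ℕ)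
    (c : ℤ) (h : ∀ x, c ≤ x → A.south (r (x + Q)) = A.south (r x)) :
    ∃ c', (∀ x, c' ≤ x → r (x + Q) = r x) ∨
      ∀ x, c' ≤ x → r (x + ((A.cells ×ˢ A.cells).card.factorial : ℕ)) = r x := by
  -- Two starts at distance `Q` carry the same south letter, hence are the same bar, and the
  -- agreement then spreads east.
  by_cases hex : ∃ x, c ≤ x ∧ (r x).2 = 0 ∧ (r (x + Q)).2 = 0
  · obtain ⟨x, hx, h0, h1⟩ := hex
    refine ⟨x, Or.inl fun y hy => ?_⟩
    obtain ⟨n, rfl⟩ := Int.le.dest hy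
    clear hy
    induction n with
    | zero =>
      have h2 := h x hx
      rw [show r x = ((r x).1, 0) by rw [← h0],
        show r (x + Q) = ((r (x + Q)).1, 0) by rw [← h1]] at h2
      simp only [Nat.cast_zero, add_zero]
      exact Prod.ext (hA.south_inj _ _ h2) (h1.trans h0.symm)
    | succ n ih =>
      have h2 := h (x + n + 1) (by omega)
      rw [add_right_comm] at h2
      have h3 := hr.step_eq hr hA.south_inj ih h2
      rw [add_right_comm] at h3
      push_cast
      rwa [← add_assoc]
  · push Not at hex
    -- At most one of the two cells at distance `Q` starts a bar: the other one is forced, and its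
    -- south letter forces the first.
    have det : ∀ x y, c ≤ x → c ≤ y → (r x, r (x + Q)) = (r y, r (y + Q)) →
        (r (x + 1), r (x + 1 + Q)) = (r (y + 1), r (y + 1 + Q)) := by
      intro x y hx hy hxy
      simp only [Prod.mk.injEq] at hxy ⊢
      obtain ⟨h0, h1⟩ := hxy
      have hx' := h (x + 1) (by omega)
      have hy' := h (y + 1) (by omega)
      rw [add_right_comm x, add_right_comm y]
      rw [add_right_comm] at hx' hy'
      rcases hr.step hr h0 with e | ⟨e, -⟩
      · exact ⟨e, hr.step_eq hr hA.south_inj h1 (by rw [hx', hy', e])⟩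
      · rcases hr.step hr h1 with e' | ⟨e', -⟩
        · exact ⟨hr.step_eq hr hA.south_inj h0 (by rw [← hx', ← hy', e']), e'⟩
        · exact absurd (by rwa [add_right_comm] at e') (hex (x + 1) (by omega) e)
    obtain ⟨c', hc'⟩ := exists_factorial_period (fun x => (r x, r (x + Q))) (A.cells ×ˢ A.cells) c
      (fun x _ => by simp only [Finset.mem_product, hr.mem_cells, and_self]) det
    exact ⟨c', Or.inr fun x hx => congrArg Prod.fst (hc' x hx)⟩

/-- Marked bars that tile the plane tile it periodically. -/
theorem IsTiling.hasPeriodic_of_marked (hA : A.Marked) {T : ℤ → ℤ → Bool × ℕ}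
    (hT : A.IsTiling T) : A.HasPeriodic := by
  by_cases hcol : ∃ x, ∀ j, 0 ≤ j → j ≤ 3 → (T j x).2 = 0
  · obtain ⟨x, hx⟩ := hcol
    exact hT.hasPeriodic_of_column hA hx
  push Not at hcol
  obtain ⟨Q, hQ, c, hc⟩ := hT.exists_period_of_no_column hA hcol
  have multiple : ∀ (j : ℤ) (c : ℤ) (P R : ℕ), P ∣ R → (∀ x, c ≤ x → T j (x + P) = T j x) →
      ∀ x, c ≤ x → T j (x + R) = T j x := by
    rintro j c P _ ⟨k, rfl⟩ h x hx
    rw [← eq_add_mul_of_periodic_from (Int.natCast_nonneg P) h k hx]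
    push_cast
    rw [mul_comm]
  obtain ⟨R, hR⟩ : ∃ R, R = (A.cells ×ˢ A.cells).card.factorial := ⟨_, rfl⟩
  refine hT.hasPeriodic_of_rows (Q * R) (Nat.mul_pos hQ (hR ▸ Nat.factorial_pos _)) fun j => ?_
  -- The period must not grow with `j`: a change of period always leads to `R`, so `Q * R` serves
  -- every row.
  suffices ∃ P : ℕ, (P = Q ∨ P = R) ∧ ∃ c, ∀ x, c ≤ x → T j (x + P) = T j x by
    obtain ⟨P, hP, c, h⟩ := this
    refine ⟨c, multiple j c P _ ?_ h⟩
    rcases hP with rfl | rfl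
    exacts [dvd_mul_right _ _, dvd_mul_left _ _]
  induction j with
  | zero => exact ⟨Q, Or.inl rfl, c, hc⟩
  | succ j ih =>
    obtain ⟨P, hP, c, h⟩ := ih
    push_cast
    obtain ⟨c', h' | h'⟩ := (hT.row (j + 1)).exists_period hA P c fun x hx => by
      rw [← hT.vert, ← hT.vert, h x hx]
    · exact ⟨P, hP, c', h'⟩
    · exact ⟨R, Or.inr rfl, c', hR ▸ h'⟩

/-! ### The general case -/

/-- If horizontal successions are not restricted and the plane can be tiled, it can be tiled
periodically. -/
theorem IsTiling.hasPeriodic_of_free (hA : A.Free) {T : ℤ → ℤ → Bool × ℕ} (hT : A.IsTiling T) :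
    A.HasPeriodic := by
  classical
  by_contra hno
  have hN : ∃ i : ℕ, A.north (true, i % A.len true) ≠ A.north (false, i % A.len false) := by
    by_contra! h
    exact hno (hT.hasPeriodic_of_commute hA A.north (Or.inl rfl) h)
  have hS : ∃ i : ℕ, A.south (true, i % A.len true) ≠ A.south (false, i % A.len false) := by
    by_contra! h
    exact hno (hT.hasPeriodic_of_commute hA A.south (Or.inr rfl) h)
  -- Rotation by the first place of disagreement brings differing letters to the front.
  have hk := fun i hi => not_not.1 (Nat.find_min (m := i) hN hi)
  have hl := fun i hi => not_not.1 (Nat.find_min (m := i) hS hi)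
  have inj : ∀ g : Bool → C, g true ≠ g false → ∀ b b', g b = g b' → b = b' := by
    rintro g hg (_ | _) (_ | _) h
    exacts [rfl, absurd h.symm hg, absurd h hg, rfl]
  refine hno (hasPeriodic_of_conj hk hl ((hT.conj hk hl).hasPeriodic_of_marked
    { next := hA.next, pos := hA.pos, north_inj := inj _ (Nat.find_spec hN),
      south_inj := inj _ (Nat.find_spec hS) }))

/-- At the end of a started bar there is an admissible successor. -/
theorem IsRow.exists_next {r : ℤ → Bool × ℕ} (hr : A.IsRow r) {x : ℤ} (h : (r x).2 = 0) :
    ∃ b, A.next (r x).1 b := by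
  have h0 := (hr x).lt
  have h1 := hr.run (b := (r x).1) (by rw [← h]) (A.len (r x).1 - 1) (by omega)
  have h2 := ((hr _).atEnd (by rw [h1]; dsimp only; omega)).2
  rw [h1] at h2
  exact ⟨_, h2⟩

/-- If successions are given by matching colours and the plane can be tiled, it can be tiled
periodically. -/
theorem IsTiling.hasPeriodic {D : Type*} {e w : Bool → D} (h : ∀ b b', A.next b b' ↔ e b = w b')
    {T : ℤ → ℤ → Bool × ℕ} (hT : A.IsTiling T) : A.HasPeriodic := by
  by_cases hA : (∀ b b', A.next b b') ∧ ∀ b, 0 < A.len b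
  · exact hT.hasPeriodic_of_free ⟨hA.1, hA.2⟩
  refine hT.hasPeriodic_of_deterministic fun j x y hxy => ?_
  rcases (hT.row j).step (hT.row j) hxy with he | ⟨hx, hy⟩
  · exact he
  refine Prod.ext ?_ (hx.trans hy.symm)
  by_contra hne
  apply hA
  -- Two different successors of one cell are all the bars. Hence all west colours agree, each east
  -- colour equals some west colour, and both bars are nonempty, so the system would be free.
  have both : ∀ P : Bool → Prop, P (T j (x + 1)).1 → P (T j (y + 1)).1 → ∀ b, P b := by
    intro P h1 h2 b
    revert h1 h2 hne
    cases b <;> cases (T j (x + 1)).1 <;> cases (T j (y + 1)).1 <;> simp +contextual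
  have hend : (T j x).2 + 1 = A.len (T j x).1 := by
    by_contra hin
    have := (hT.row j x).inside (lt_of_le_of_ne (hT.row j x).lt hin)
    rw [this] at hx
    simp at hx
  have hw : ∀ b, e (T j x).1 = w b := both _ ((h _ _).1 ((hT.row j x).atEnd hend).2)
    ((h _ _).1 (by rw [hxy]; exact ((hT.row j y).atEnd (hxy ▸ hend)).2))
  have he : ∀ b, ∃ b', e b = w b' := both _
    (((hT.row j).exists_next hx).imp fun _ => (h _ _).1)
    (((hT.row j).exists_next hy).imp fun _ => (h _ _).1)
  refine ⟨fun b b' => (h _ _).2 ?_, both _ ?_ ?_⟩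
  · obtain ⟨b'', hb⟩ := he b
    rw [hb, ← hw, hw]
  · have := (hT.row j (x + 1)).lt; omega
  · have := (hT.row j (y + 1)).lt; omega

end BarSystem

/-! ### From Wang bars to bar systems and back -/

namespace WangBar

/-- The bar system given by two Wang bars. -/
def system {C : Type*} (bar : Bool → WangBar C) : BarSystem (Option C) where
  len b := (bar b).length
  next b b' := (bar b).east = (bar b').west
  north s := (bar s.1).north[s.2]?
  south s := (bar s.1).south[s.2]?

theorem TilesPlane.exists_isTiling {C : Type*} {bar : Bool → WangBar C}
    (h : TilesPlane (Set.range bar)) : ∃ T, (system bar).IsTiling T := by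
  obtain ⟨f, p, hT⟩ := h
  -- The two labels may name the same bar, so a label is chosen.
  have hl : ∀ i j, bar (Function.invFun bar (f i j)) = f i j := fun i j =>
    Function.invFun_eq (hT.mem i j)
  refine ⟨fun j x => (Function.invFun bar (f x j), p x j - 1), ⟨fun j x => ⟨?_, ?_, ?_⟩,
    fun j x => ?_⟩⟩
  · have h1 := hT.pos x j
    have h2 := hT.le_length x j
    simp only [system, hl]
    omega
  · intro hlt
    have h1 := hT.pos x j
    simp only [system, hl] at hlt
    obtain ⟨h2, h3⟩ := hT.inside x j (by omega)
    rw [h2, h3]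
    congr 1
    omega
  · intro he
    have h1 := hT.pos x j
    simp only [system, hl] at he ⊢
    obtain ⟨h2, h3⟩ := hT.atEnd x j (by omega)
    exact ⟨by rw [h2], h3⟩
  · simp only [system, hl]
    exact hT.vertical x j

theorem hasPeriodicTiling_of_system {C : Type*} {bar : Bool → WangBar C}
    (h : (system bar).HasPeriodic) : HasPeriodicTiling (Set.range bar) := by
  obtain ⟨T, hT, n, hn, hp⟩ := h
  refine ⟨fun x j => bar (T j x).1, fun x j => (T j x).2 + 1,
    ⟨fun x j => ⟨_, rfl⟩, fun x j => Nat.succ_pos _, fun x j => (hT.row j x).lt,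
      fun x j hlt => ?_, fun x j he => ?_, fun x j => hT.vert j x⟩,
    n, hn, fun x j => ?_⟩
  · rw [(hT.row j x).inside hlt]
    exact ⟨rfl, rfl⟩
  · obtain ⟨h1, h2⟩ := (hT.row j x).atEnd he
    exact ⟨by rw [h1], h2⟩
  · simp only [(hp j x).1, (hp j x).2, and_self]

theorem HasPeriodicTiling.tilesPlane {C : Type*} {B : Set (WangBar C)} (h : HasPeriodicTiling B) :
    TilesPlane B := by
  obtain ⟨f, p, hT, -⟩ := h
  exact ⟨f, p, hT⟩

theorem TilesPlane.hasPeriodic_system {C : Type*} {bar : Bool → WangBar C}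
    (h : TilesPlane (Set.range bar)) : (system bar).HasPeriodic := by
  obtain ⟨T, hT⟩ := h.exists_isTiling
  exact hT.hasPeriodic (e := fun b => (bar b).east) (w := fun b => (bar b).west) fun _ _ => Iff.rfl

theorem range_cond {C : Type*} (α β : WangBar C) :
    Set.range (fun b => bif b then α else β) = {α, β} := by
  ext x
  simp [eq_comm, or_comm]

theorem tilesPlane_iff_hasPeriodicTiling {C : Type*} {B : Set (WangBar C)} (hB : B.ncard = 2) :
    TilesPlane B ↔ HasPeriodicTiling B := by
  obtain ⟨α, β, -, rfl⟩ := Set.ncard_eq_two.1 hB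
  rw [← range_cond]
  exact ⟨fun h => hasPeriodicTiling_of_system h.hasPeriodic_system, fun h => h.tilesPlane⟩

end WangBar

/-! ### Compactness and coding of finite patches -/

namespace BarSystem
variable {C : Type*} {A : BarSystem C}

/-- The cell `s` matches its east neighbour `t` and its north neighbour `u`. -/
def Fits {C : Type*} (A : BarSystem C) (s t u : Bool × ℕ) : Prop :=
  A.Adj s t ∧ A.north s = A.south u

theorem isTiling_iff {T : ℤ → ℤ → Bool × ℕ} :
    A.IsTiling T ↔ ∀ j x, A.Fits (T j x) (T j (x + 1)) (T (j + 1) x) :=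
  ⟨fun h j x => ⟨h.row j x, h.vert j x⟩, fun h => ⟨fun j x => (h j x).1, fun j x => (h j x).2⟩⟩

/-- If all squares can be tiled with finitely many cells, so can the plane. -/
theorem exists_isTiling_of_squares (F : Finset (Bool × ℕ))
    (h : ∀ n : ℕ, ∃ g : ℕ → ℕ → Bool × ℕ, (∀ j x, g j x ∈ F) ∧
      ∀ j < n, ∀ x < n, A.Fits (g j x) (g j (x + 1)) (g (j + 1) x)) :
    ∃ T, A.IsTiling T := by
  let t : ℕ → Set (ℤ → ℤ → F) := fun N =>
    ⋂ (j : ℤ) (_ : -N ≤ j ∧ j ≤ N) (x : ℤ) (_ : -N ≤ x ∧ x ≤ N),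
      {T | A.Fits (T j x) (T j (x + 1)) (T (j + 1) x)}
  have hcl : ∀ N, IsClosed (t N) := by
    intro N
    refine isClosed_iInter fun j => isClosed_iInter fun _ => isClosed_iInter fun x =>
        isClosed_iInter fun _ => ?_
    have hc : Continuous fun T : ℤ → ℤ → F => (T j x, T j (x + 1), T (j + 1) x) := by fun_prop
    exact (isClosed_discrete {p : F × F × F | A.Fits p.1 p.2.1 p.2.2}).preimage hc
  have hne : (⋂ N, t N).Nonempty := by
    refine IsCompact.nonempty_iInter_of_sequence_nonempty_isCompact_isClosed t (fun N T hT => ?_)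
      (fun N => ?_) (hcl 0).isCompact hcl
    · simp only [t, Set.mem_iInter, Set.mem_ofPred_eq] at hT ⊢
      intro j hj x hx
      exact hT j (by push_cast; omega) x (by push_cast; omega)
    · obtain ⟨g, hgF, hg⟩ := h (2 * N + 1)
      -- The square of side `2 * N + 1` is recentred at the origin; truncation by `toNat` acts only
      -- outside it.
      refine ⟨fun j x => ⟨g (j + N).toNat (x + N).toNat, hgF _ _⟩, ?_⟩
      simp only [t, Set.mem_iInter, Set.mem_ofPred_eq]
      intro j hj x hx
      have := hg (j + N).toNat (by omega) (x + N).toNat (by omega)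
      rwa [show (j + N).toNat + 1 = (j + 1 + N).toNat by omega,
        show (x + N).toNat + 1 = (x + 1 + N).toNat by omega] at this
  obtain ⟨T, hT⟩ := hne
  refine ⟨fun j x => T j x, isTiling_iff.2 fun j x => ?_⟩
  have h1 := Set.mem_iInter.1 hT (j.natAbs + x.natAbs)
  simp only [t, Set.mem_iInter, Set.mem_ofPred_eq] at h1
  exact h1 j (by omega) x (by omega)

/-- The cell with a given code. -/
def cellOf (s : ℕ) : Bool × ℕ := (s.bodd, s.div2)

theorem exists_cellOf {K : ℕ} (hK : ∀ b, 2 * A.len b < K) {s : Bool × ℕ}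
    (hs : s.2 < A.len s.1) : ∃ c < K, cellOf c = s := by
  refine ⟨Nat.bit s.1 s.2, ?_, by simp [cellOf]⟩
  have := hK s.1
  rw [Nat.bit_val]
  have := Bool.toNat_le s.1
  omega

theorem exists_digits {K : ℕ} (f : ℕ → ℕ) (hf : ∀ i, f i < K) (n : ℕ) :
    ∃ c < K ^ n, ∀ i < n, c / K ^ i % K = f i := by
  induction n generalizing f with
  | zero => exact ⟨0, by simp, by simp⟩
  | succ n ih =>
    obtain ⟨c, hc, h⟩ := ih (fun i => f (i + 1)) fun i => hf _
    have h0 := hf 0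
    refine ⟨f 0 + K * c, ?_, ?_⟩
    · rw [pow_succ']
      nlinarith [Nat.mul_le_mul_left K (Nat.succ_le_of_lt hc)]
    · rintro (_ | i) hi
      · simp [Nat.mod_eq_of_lt h0]
      · rw [pow_succ', ← Nat.div_div_eq_div_mul, Nat.add_mul_div_left _ _ (by omega),
          Nat.div_eq_of_lt h0, zero_add]
        exact h i (by omega)

/-- The cell with index `i` of the patch with code `c`, in base `K`. -/
def patchCell (K c i : ℕ) : Bool × ℕ := cellOf (c / K ^ i % K)

theorem exists_patchCell {K : ℕ} (hK : ∀ b, 2 * A.len b < K) (f : ℕ → Bool × ℕ)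
    (hf : ∀ i, (f i).2 < A.len (f i).1) (n : ℕ) :
    ∃ c < K ^ n, ∀ i < n, patchCell K c i = f i := by
  choose g hgK hg using fun i => exists_cellOf hK (hf i)
  obtain ⟨c, hc, h⟩ := exists_digits g hgK n
  exact ⟨c, hc, fun i hi => by rw [patchCell, h i hi, hg]⟩

/-- `c` codes a tiling of the torus of size `n × n`. -/
def TorusPatch {C : Type*} (A : BarSystem C) (K n c : ℕ) : Prop :=
  ∀ j < n, ∀ x < n, A.Fits (patchCell K c (j * n + x)) (patchCell K c (j * n + (x + 1) % n))
    (patchCell K c ((j + 1) % n * n + x))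

/-- `c` codes a tiling of the square of size `n × n`, together with a northern and an eastern
margin. -/
def SquarePatch {C : Type*} (A : BarSystem C) (K n c : ℕ) : Prop :=
  ∀ j < n, ∀ x < n, A.Fits (patchCell K c (j * (n + 1) + x)) (patchCell K c (j * (n + 1) + (x + 1)))
    (patchCell K c ((j + 1) * (n + 1) + x))

theorem mul_add_lt_sq {n j x : ℕ} (hj : j < n) (hx : x < n) : j * n + x < n * n := by
  nlinarith [Nat.mul_le_mul_right n (Nat.succ_le_of_lt hj)]

/-- An array of cells with `n` columns, written as a sequence. -/
theorem exists_patchCell_array {K : ℕ} (hK : ∀ b, 2 * A.len b < K) (f : ℕ → ℕ → Bool × ℕ)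
    (hf : ∀ j x, (f j x).2 < A.len (f j x).1) (n : ℕ) :
    ∃ c < K ^ (n * n), ∀ j < n, ∀ x < n, patchCell K c (j * n + x) = f j x := by
  obtain ⟨c, hc, h⟩ := exists_patchCell hK (fun i => f (i / n) (i % n)) (fun i => hf _ _) (n * n)
  refine ⟨c, hc, fun j hj x hx => ?_⟩
  rw [h _ (mul_add_lt_sq hj hx)]
  have hn : 0 < n := by omega
  rw [mul_comm, Nat.mul_add_div hn, Nat.div_eq_of_lt hx, add_zero, Nat.mul_add_mod,
    Nat.mod_eq_of_lt hx]

/-- Makes periodicity an unbounded search for a finite object; `n + 1` excludes the empty torus. -/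
theorem hasPeriodic_iff {K : ℕ} (hK : ∀ b, 2 * A.len b < K) :
    A.HasPeriodic ↔ ∃ n c, A.TorusPatch K (n + 1) c := by
  constructor
  · rintro ⟨T, hT, n, hn, hp⟩
    obtain ⟨m, rfl⟩ : ∃ m : ℕ, n = (m + 1 : ℕ) := ⟨n.toNat - 1, by omega⟩
    obtain ⟨c, -, hc⟩ := exists_patchCell_array hK (fun j x : ℕ => T j x)
      (fun j x => (hT.row j x).lt) (m + 1)
    have hmod : ∀ j < m + 1, (j + 1) % (m + 1) = j + 1 ∧ j + 1 < m + 1 ∨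
        (j + 1) % (m + 1) = 0 ∧ j + 1 = m + 1 := by
      intro j hj
      rcases Nat.lt_or_ge (j + 1) (m + 1) with h | h
      · exact Or.inl ⟨Nat.mod_eq_of_lt h, h⟩
      · have h : j + 1 = m + 1 := by omega
        exact Or.inr ⟨by rw [h, Nat.mod_self], h⟩
    refine ⟨m, c, fun j hj x hx => ?_⟩
    rw [hc j hj x hx, hc j hj _ (Nat.mod_lt _ (by omega)), hc _ (Nat.mod_lt _ (by omega)) x hx]
    have e1 : T j ((x + 1) % (m + 1) : ℕ) = T j (x + 1) := by
      rcases hmod x hx with ⟨h, -⟩ | ⟨h, h'⟩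
      · rw [h]; rfl
      · have := (hp j 0).1
        rw [h, Nat.cast_zero, ← this, ← h', zero_add]; rfl
    have e2 : T ((j + 1) % (m + 1) : ℕ) x = T (j + 1) x := by
      rcases hmod j hj with ⟨h, -⟩ | ⟨h, h'⟩
      · rw [h]; rfl
      · have := (hp 0 x).2
        rw [h, Nat.cast_zero, ← this, ← h', zero_add]; rfl
    rw [e1, e2]
    exact isTiling_iff.1 hT j x
  · rintro ⟨m, c, h⟩
    obtain ⟨n, hn⟩ : ∃ n : ℕ, n = m + 1 := ⟨_, rfl⟩
    rw [← hn] at h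
    have hn0 : 0 < n := by omega
    have hn' : (0 : ℤ) < n := by omega
    have hlt : ∀ x : ℤ, (x % n).toNat < n := fun x => by
      have := Int.emod_lt_of_pos x hn'
      omega
    have hsucc : ∀ x : ℤ, ((x % n).toNat + 1) % n = ((x + 1) % n).toNat := by
      intro x
      have h1 := Int.emod_nonneg x hn'.ne'
      rcases emod_succ_cases x hn' with ⟨h, h'⟩ | ⟨h, h'⟩
      · rw [h, Nat.mod_eq_of_lt (by omega)]; omega
      · rw [h, show (x % n).toNat + 1 = n by omega, Nat.mod_self]; rfl
    refine ⟨fun j x => patchCell K c ((j % n).toNat * n + (x % n).toNat),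
      isTiling_iff.2 fun j x => ?_, n, hn', fun j x => by simp⟩
    have := h _ (hlt j) _ (hlt x)
    rwa [hsucc, hsucc] at this

/-- The bound on `c` makes the inner search finite, so that failure at some `n` can be detected. -/
theorem exists_isTiling_iff {K : ℕ} (hK : ∀ b, 2 * A.len b < K) :
    (∃ T, A.IsTiling T) ↔ ∀ n, ∃ c < K ^ ((n + 1) * (n + 1)), A.SquarePatch K n c := by
  constructor
  · rintro ⟨T, hT⟩ n
    obtain ⟨c, hcK, hc⟩ := exists_patchCell_array hK (fun j x : ℕ => T j x)
      (fun j x => (hT.row j x).lt) (n + 1)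
    refine ⟨c, hcK, fun j hj x hx => ?_⟩
    rw [hc j (by omega) x (by omega), hc j (by omega) (x + 1) (by omega),
      hc (j + 1) (by omega) x (by omega)]
    exact isTiling_iff.1 hT j x
  · intro h
    refine exists_isTiling_of_squares ((Finset.range K).image cellOf) fun n => ?_
    obtain ⟨c, -, hc⟩ := h n
    refine ⟨fun j x => patchCell K c (j * (n + 1) + x), fun j x => ?_, hc⟩
    exact Finset.mem_image_of_mem _ (Finset.mem_range.2 (Nat.mod_lt _ (by have := hK true; omega)))

end BarSystem

/-! ### Primitive recursiveness and decidability -/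

namespace WangBar
open Primrec

/-- The two bars of a pair, labelled by `Bool`. -/
def pairBar {C : Type*} (P : WangBar C × WangBar C) (b : Bool) : WangBar C := bif b then P.1 else P.2

/-- A base for coding the cells of two bars. -/
def base {C : Type*} (P : WangBar C × WangBar C) : ℕ := 2 * (P.1.length + P.2.length) + 1

theorem two_mul_len_lt_base {C : Type*} (P : WangBar C × WangBar C) (b : Bool) :
    2 * (system (pairBar P)).len b < base P := by
  cases b <;> simp only [system, pairBar, base, cond_true, cond_false] <;> omega

theorem primrec_equivQuadruple : Primrec fun b : WangBar ℕ => ((equivQuadruple ℕ) b).1 :=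
  letI := Primcodable.subtype primrecPred_length_eq
  (Primrec.subtype_val (hp := primrecPred_length_eq)).comp (Primrec.of_equiv (e := equivQuadruple ℕ))

theorem primrec_east : Primrec (WangBar.east : WangBar ℕ → ℕ) := fst.comp primrec_equivQuadruple

theorem primrec_west : Primrec (WangBar.west : WangBar ℕ → ℕ) :=
  fst.comp (snd.comp primrec_equivQuadruple)

theorem primrec_north : Primrec (WangBar.north : WangBar ℕ → List ℕ) :=
  fst.comp (snd.comp (snd.comp primrec_equivQuadruple))

theorem primrec_south : Primrec (WangBar.south : WangBar ℕ → List ℕ) :=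
  snd.comp (snd.comp (snd.comp primrec_equivQuadruple))

theorem primrec_length : Primrec (WangBar.length : WangBar ℕ → ℕ) := list_length.comp primrec_north

theorem primrec_pairBar : Primrec₂ (pairBar : WangBar ℕ × WangBar ℕ → Bool → WangBar ℕ) :=
  Primrec.cond snd (fst.comp fst) (snd.comp fst)

theorem primrec_base : Primrec (base : WangBar ℕ × WangBar ℕ → ℕ) :=
  succ.comp (nat_mul.comp (const 2)
    (nat_add.comp (primrec_length.comp fst) (primrec_length.comp snd)))

theorem primrec_pow : Primrec₂ ((· ^ ·) : ℕ → ℕ → ℕ) :=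
  (Primrec.nat_rec (const 1) (nat_mul.comp (snd.comp snd) fst).to₂).of_eq fun a n => by
    induction n with
    | zero => rfl
    | succ n ih => rw [pow_succ, ← ih]

theorem primrec_patchCell : Primrec fun p : ℕ × ℕ × ℕ => BarSystem.patchCell p.1 p.2.1 p.2.2 :=
  have h : Primrec fun p : ℕ × ℕ × ℕ => p.2.1 / p.1 ^ p.2.2 % p.1 :=
    nat_mod.comp (nat_div.comp (fst.comp snd) (primrec_pow.comp fst (snd.comp snd))) fst
  (nat_bodd.comp h).pair (nat_div2.comp h)

theorem primrecPred_fits :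
    PrimrecPred fun p : (WangBar ℕ × WangBar ℕ) × (Bool × ℕ) × (Bool × ℕ) × (Bool × ℕ) =>
      (system (pairBar p.1)).Fits p.2.1 p.2.2.1 p.2.2.2 := by
  let I := (WangBar ℕ × WangBar ℕ) × (Bool × ℕ) × (Bool × ℕ) × (Bool × ℕ)
  have s : Primrec fun p : I => p.2.1 := fst.comp snd
  have t : Primrec fun p : I => p.2.2.1 := fst.comp (snd.comp snd)
  have u : Primrec fun p : I => p.2.2.2 := snd.comp (snd.comp snd)
  have bs : Primrec fun p : I => pairBar p.1 p.2.1.1 := primrec_pairBar.comp fst (fst.comp s)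
  have bt : Primrec fun p : I => pairBar p.1 p.2.2.1.1 := primrec_pairBar.comp fst (fst.comp t)
  have bu : Primrec fun p : I => pairBar p.1 p.2.2.2.1 := primrec_pairBar.comp fst (fst.comp u)
  have ls := primrec_length.comp bs
  have is := succ.comp (snd.comp s)
  have h1 := nat_lt.comp (snd.comp s) ls
  have h2 := (nat_lt.comp is ls).not.or (Primrec.eq.comp t ((fst.comp s).pair is))
  have h3 := (Primrec.eq.comp is ls).not.or ((Primrec.eq.comp (snd.comp t) (const 0)).and
    (Primrec.eq.comp (primrec_east.comp bs) (primrec_west.comp bt)))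
  have h4 := Primrec.eq.comp (list_getElem?.comp (primrec_north.comp bs) (snd.comp s))
    (list_getElem?.comp (primrec_south.comp bu) (snd.comp u))
  refine ((h1.and (h2.and h3)).and h4).of_eq fun p => ?_
  simp only [← imp_iff_not_or]
  exact ⟨fun ⟨⟨a, b, c⟩, d⟩ => ⟨⟨a, b, c⟩, d⟩, fun ⟨⟨a, b, c⟩, d⟩ => ⟨⟨a, b, c⟩, d⟩⟩

/-- A bounded universal quantifier whose bound is a primitive recursive function. -/
theorem _root_.PrimrecPred.forall_lt_of_primrec {α : Type*} [Primcodable α] {R : ℕ → α → Prop}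
    {f : α → ℕ} (hf : Primrec f) (hR : PrimrecPred fun p : ℕ × α => R p.1 p.2) :
    PrimrecPred fun a => ∀ i < f a, R i a :=
  ((PrimrecRel.forall_mem_list (R := R) hR).comp (list_range.comp hf) .id).of_eq fun a => by simp

theorem _root_.PrimrecPred.exists_lt_of_primrec {α : Type*} [Primcodable α] {R : ℕ → α → Prop}
    {f : α → ℕ} (hf : Primrec f) (hR : PrimrecPred fun p : ℕ × α => R p.1 p.2) :
    PrimrecPred fun a => ∃ i < f a, R i a :=
  ((PrimrecRel.exists_mem_list (R := R) hR).comp (list_range.comp hf) .id).of_eq fun a => by simp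

/-- A condition on the cells of a patch, each of them together with two other cells, is primitive
recursive. -/
theorem primrecPred_patch {α : Type*} [Primcodable α] {R : α → Bool × ℕ → Bool × ℕ → Bool × ℕ → Prop}
    {K : α → ℕ} (hR : PrimrecPred fun p : α × (Bool × ℕ) × (Bool × ℕ) × (Bool × ℕ) =>
      R p.1 p.2.1 p.2.2.1 p.2.2.2) (hK : Primrec K)
    {s t u : ℕ × ℕ × ℕ → ℕ} (hs : Primrec s) (ht : Primrec t) (hu : Primrec u) :
    PrimrecPred fun p : α × ℕ × ℕ => ∀ j < p.2.1, ∀ x < p.2.1, R p.1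
      (BarSystem.patchCell (K p.1) p.2.2 (s (p.2.1, j, x)))
      (BarSystem.patchCell (K p.1) p.2.2 (t (p.2.1, j, x)))
      (BarSystem.patchCell (K p.1) p.2.2 (u (p.2.1, j, x))) := by
  have hp : Primrec fun q : ℕ × ℕ × α × ℕ × ℕ => q.2.2 := snd.comp snd
  have hn := fst.comp (snd.comp hp)
  have hcell : ∀ {g : ℕ × ℕ × ℕ → ℕ}, Primrec g → Primrec fun q : ℕ × ℕ × α × ℕ × ℕ =>
      BarSystem.patchCell (K q.2.2.1) q.2.2.2.2 (g (q.2.2.2.1, q.2.1, q.1)) := fun hg =>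
    primrec_patchCell.comp ((hK.comp (fst.comp hp)).pair ((snd.comp (snd.comp hp)).pair
      (hg.comp (hn.pair ((fst.comp snd).pair fst)))))
  have h0 := hR.comp ((fst.comp hp).pair ((hcell hs).pair ((hcell ht).pair (hcell hu))))
  have h1 := PrimrecPred.forall_lt_of_primrec
    (R := fun (x : ℕ) (q : ℕ × α × ℕ × ℕ) => R q.2.1
      (BarSystem.patchCell (K q.2.1) q.2.2.2 (s (q.2.2.1, q.1, x)))
      (BarSystem.patchCell (K q.2.1) q.2.2.2 (t (q.2.2.1, q.1, x)))
      (BarSystem.patchCell (K q.2.1) q.2.2.2 (u (q.2.2.1, q.1, x))))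
    (f := fun q => q.2.2.1) (fst.comp (snd.comp snd)) h0
  exact PrimrecPred.forall_lt_of_primrec
    (R := fun (j : ℕ) (p : α × ℕ × ℕ) => ∀ x < p.2.1, R p.1
      (BarSystem.patchCell (K p.1) p.2.2 (s (p.2.1, j, x)))
      (BarSystem.patchCell (K p.1) p.2.2 (t (p.2.1, j, x)))
      (BarSystem.patchCell (K p.1) p.2.2 (u (p.2.1, j, x))))
    (f := fun p => p.2.1) (fst.comp snd) h1

theorem primrecPred_torusPatch : PrimrecPred fun p : (WangBar ℕ × WangBar ℕ) × ℕ × ℕ =>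
    (system (pairBar p.1)).TorusPatch (base p.1) p.2.1 p.2.2 := by
  have n : Primrec fun q : ℕ × ℕ × ℕ => q.1 := fst
  have j : Primrec fun q : ℕ × ℕ × ℕ => q.2.1 := fst.comp snd
  have x : Primrec fun q : ℕ × ℕ × ℕ => q.2.2 := snd.comp snd
  have h := primrecPred_patch (R := fun P => (system (pairBar P)).Fits) primrecPred_fits
    primrec_base (s := fun q => q.2.1 * q.1 + q.2.2)
    (t := fun q => q.2.1 * q.1 + (q.2.2 + 1) % q.1)
    (u := fun q => (q.2.1 + 1) % q.1 * q.1 + q.2.2)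
    (nat_add.comp (nat_mul.comp j n) x)
    (nat_add.comp (nat_mul.comp j n) (nat_mod.comp (succ.comp x) n))
    (nat_add.comp (nat_mul.comp (nat_mod.comp (succ.comp j) n) n) x)
  exact h

theorem primrecPred_squarePatch : PrimrecPred fun p : (WangBar ℕ × WangBar ℕ) × ℕ × ℕ =>
    (system (pairBar p.1)).SquarePatch (base p.1) p.2.1 p.2.2 := by
  have n : Primrec fun q : ℕ × ℕ × ℕ => q.1 + 1 := succ.comp fst
  have j : Primrec fun q : ℕ × ℕ × ℕ => q.2.1 := fst.comp snd
  have x : Primrec fun q : ℕ × ℕ × ℕ => q.2.2 := snd.comp snd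
  have h := primrecPred_patch (R := fun P => (system (pairBar P)).Fits) primrecPred_fits
    primrec_base (s := fun q => q.2.1 * (q.1 + 1) + q.2.2)
    (t := fun q => q.2.1 * (q.1 + 1) + (q.2.2 + 1))
    (u := fun q => (q.2.1 + 1) * (q.1 + 1) + q.2.2)
    (nat_add.comp (nat_mul.comp j n) x)
    (nat_add.comp (nat_mul.comp j n) (succ.comp x))
    (nat_add.comp (nat_mul.comp (succ.comp j) n) x)
  exact h

/-- The projection of a primitive recursive relation is recursively enumerable. -/
theorem _root_.PrimrecRel.rePred_exists {α : Type*} [Primcodable α] {R : α → ℕ → Prop}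
    (hR : PrimrecRel R) : REPred fun a => ∃ n, R a n := by
  classical
  have h := hR.decide
  have hp : Partrec fun a => Nat.rfind fun n => Part.some (decide (R a n)) :=
    Partrec.rfind h.to_comp.partrec
  refine hp.dom_re.of_eq fun a => ?_
  refine Nat.rfind_dom.trans ⟨fun ⟨n, hn, _⟩ => ⟨n, ?_⟩, fun ⟨n, hn⟩ => ⟨n, ?_, fun _ => trivial⟩⟩
  · exact of_decide_eq_true (Part.mem_some_iff.1 hn).symm
  · exact Part.mem_some_iff.2 (decide_eq_true hn).symm

theorem range_pairBar {C : Type*} (P : WangBar C × WangBar C) :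
    Set.range (pairBar P) = {P.1, P.2} := range_cond P.1 P.2

/-- Post's theorem: torus patches enumerate the tileable pairs, and squares without a patch
enumerate the others. -/
theorem computablePred_tilesPlane : ComputablePred fun P : WangBar ℕ × WangBar ℕ =>
    TilesPlane ({P.1, P.2} : Set (WangBar ℕ)) := by
  refine ComputablePred.computable_iff_re_compl_re'.2 ⟨?_, ?_⟩
  · have h : PrimrecRel fun (P : WangBar ℕ × WangBar ℕ) (w : ℕ) =>
        (system (pairBar P)).TorusPatch (base P) (w.unpair.1 + 1) w.unpair.2 :=
      primrecPred_torusPatch.comp (fst.pair ((succ.comp (fst.comp (unpair.comp snd))).pair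
        (snd.comp (unpair.comp snd))))
    refine h.rePred_exists.of_eq fun P => ?_
    rw [← range_pairBar]
    have h1 := BarSystem.hasPeriodic_iff (two_mul_len_lt_base P)
    refine Iff.trans ⟨fun ⟨w, hw⟩ => h1.2 ⟨_, _, hw⟩, fun hP => ?_⟩
      ⟨fun hP => (hasPeriodicTiling_of_system hP).tilesPlane, fun hP => hP.hasPeriodic_system⟩
    obtain ⟨n, c, hc⟩ := h1.1 hP
    exact ⟨Nat.pair n c, by simpa using hc⟩
  · have h : PrimrecRel fun (P : WangBar ℕ × WangBar ℕ) (n : ℕ) =>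
        ¬∃ c < base P ^ ((n + 1) * (n + 1)),
          (system (pairBar P)).SquarePatch (base P) n c :=
      (PrimrecPred.exists_lt_of_primrec
        (R := fun c (p : (WangBar ℕ × WangBar ℕ) × ℕ) =>
          (system (pairBar p.1)).SquarePatch (base p.1) p.2 c)
        (primrec_pow.comp (primrec_base.comp fst) (nat_mul.comp (succ.comp snd) (succ.comp snd)))
        (primrecPred_squarePatch.comp
          ((fst.comp snd).pair ((snd.comp snd).pair fst)))).not
    refine h.rePred_exists.of_eq fun P => ?_
    rw [← range_pairBar, ← not_forall,
      ← BarSystem.exists_isTiling_iff (two_mul_len_lt_base P)]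
    exact not_congr ⟨fun ⟨T, hT⟩ => (hasPeriodicTiling_of_system (hT.hasPeriodic
      (e := fun b => (pairBar P b).east) (w := fun b => (pairBar P b).west)
      fun _ _ => Iff.rfl)).tilesPlane, fun hP => hP.exists_isTiling⟩

end WangBar

theorem mainTheorem4 :
    (∀ (C : Type*) (B : Set (WangBar C)), B.ncard = 2 →
      (WangBar.TilesPlane B ↔ WangBar.HasPeriodicTiling B)) ∧
    ComputablePred (fun P : WangBar ℕ × WangBar ℕ =>
      WangBar.TilesPlane ({P.1, P.2} : Set (WangBar ℕ))) :=
  ⟨fun _ _ hB => WangBar.tilesPlane_iff_hasPeriodicTiling hB, WangBar.computablePred_tilesPlane⟩
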